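/- Let $S$ be a commutative semiring with $1$. A strong ideal of $S$ is an ideal $I$ such that, for all $a,b\in S$, $a+b\in I$ implies $a\in I$ and $b\in I$. For a collection $X$ of ideals of $S$, the hull-kernel topology on $X$ is the topology having the sets $\{I\in X \mid A\nsubseteq I\}$, $A$ a finite subset of $S$, as a subbasis of open sets (equivalently, the sets $\{I\in X\mid A\subseteq I\}$ as a subbasis of closed sets). The power set $2^S$ carries the analogous topology, with subbasic open sets $\{I\in 2^S\mid A\nsubseteq I\}$, $A\subseteq S$ finite; the patch topology on $2^S$ is the topology generated by the quasi-compact open sets of that topology together with their complements. A space is spectral if it is quasi-compact, $T_0$ and sober, its quasi-compact open sets form a basis, and the intersection of any two quasi-compact open sets is quasi-compact. Then: 1. The collection of all strong ideals of $S$, with the hull-kernel topology, is a spectral space, and it is a patch-closed subset of $2^S$. The same holds for the collection of all proper strong ideals of $S$. 2. The collection of all strong prime ideals of $S$, with the hull-kernel topology, is a spectral space, and it is a patch-closed subset of $2^S$. -/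

import Mathlib

open Topology

/-- An ideal `I` of a semiring is strong if `a + b ∈ I` implies `a ∈ I` and `b ∈ I`. -/
def Ideal.IsStrong {S : Type*} [CommSemiring S] (I : Ideal S) : Prop :=
  ∀ a b : S, a + b ∈ I → a ∈ I ∧ b ∈ I

/-- The collection of all strong ideals of `S` (including the improper ideal `S`). -/
def strongIdeals (S : Type*) [CommSemiring S] : Set (Ideal S) :=
  {I | I.IsStrong}

/-- The collection of all proper strong ideals of `S`. -/
def properStrongIdeals (S : Type*) [CommSemiring S] : Set (Ideal S) :=
  {I | I ≠ ⊤ ∧ I.IsStrong}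

/-- The collection of all strong prime ideals of `S`. -/
def strongPrimeIdeals (S : Type*) [CommSemiring S] : Set (Ideal S) :=
  {I | I.IsPrime ∧ I.IsStrong}

/-- The hull-kernel topology on `2^S`: the sets `D(A) = {I | A ⊈ I}`, for finite `A ⊆ S`, form a
subbasis of open sets; equivalently, the hulls `{I | A ⊆ I}` form a subbasis of closed sets. -/
abbrev powersetHullKernel (S : Type*) : TopologicalSpace (Set S) :=
  TopologicalSpace.generateFrom {U | ∃ A : Finset S, U = {I : Set S | ¬ (A : Set S) ⊆ I}}

/-- The hull-kernel topology on a collection `X` of ideals of `S`: the sets `{I ∈ X | A ⊈ I}`, for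
finite `A ⊆ S`, form a subbasis of open sets. -/
abbrev hullKernel {S : Type*} [CommSemiring S] (X : Set (Ideal S)) : TopologicalSpace X :=
  TopologicalSpace.generateFrom {U | ∃ A : Finset S, U = {I : X | ¬ (A : Set S) ⊆ (I : Ideal S)}}

/-- The patch topology on `2^S`: the constructible topology of the hull-kernel topology, generated
by the quasi-compact open sets (of the hull-kernel topology) and their complements. -/
abbrev powersetPatch (S : Type*) : TopologicalSpace (Set S) :=
  @constructibleTopology (Set S) (powersetHullKernel S)

/-- A collection of ideals of `S`, regarded as a subset of `2^S`, is patch-closed. -/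
def IsPatchClosed {S : Type*} [CommSemiring S] (X : Set (Ideal S)) : Prop :=
  IsClosed[powersetPatch S] ((fun I : Ideal S => (I : Set S)) '' X)

/-!
An arbitrary hull is an intersection of hulls of singletons, so `2^S` is an algebraic lattice with
its lower topology. Such a lattice is spectral: an irreducible closed set has its infimum as generic
point, and compact elements give quasi-compact open sets. The sets `{A | a ∈ A}` are then clopen in
the patch topology. Being an ideal, strong, proper or prime is a conjunction of implications between
finite combinations of such membership conditions, hence patch-closed. Finally, a patch-closed
subspace `X` of a spectral space is spectral: it is patch-compact, and the generic point of the
closure of an irreducible subset `s` of `X` lies in the patch closure of `s`, hence in `X`.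
-/

open Set Filter TopologicalSpace

section ConstructibleTopology

variable {X Y : Type*} [TopologicalSpace X] [TopologicalSpace Y] {f : X → Y}

theorem isClopen_constructibleTopology_of_isCompact {K : Set X} (ho : IsOpen K) (hc : IsCompact K) :
    @IsClopen X (constructibleTopology X) K :=
  ⟨(@isOpen_compl_iff X K (constructibleTopology X)).1
      (IsCompact.isOpen_constructibleTopology_of_isClosed (by rwa [compl_compl]) ho.isClosed_compl),
    hc.isOpen_constructibleTopology_of_isOpen ho⟩

theorem constructibleTopology_le [PrespectralSpace X] :
    constructibleTopology X ≤ ‹TopologicalSpace X› :=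
  (generateFrom_anti subset_union_left).trans_eq
    PrespectralSpace.isTopologicalBasis.eq_generateFrom.symm

theorem isCompact_of_isClosed_constructibleTopology [CompactSpace X] [QuasiSober X]
    [PrespectralSpace X] [QuasiSeparatedSpace X] {s : Set X}
    (hs : IsClosed[constructibleTopology X] s) : IsCompact s := by
  let e : WithConstructibleTopology X → X := WithTopology.ofTopology
  have he : Continuous e :=
    continuous_le_rng constructibleTopology_le (WithTopology.continuous_ofTopology _)
  have hes : IsCompact (e ⁻¹' s) :=
    ((WithConstructibleTopology.isClosed_iff (s := e ⁻¹' s)).2 hs).isCompact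
  exact image_preimage_eq s (WithTopology.ofTopology_surjective _) ▸ hes.image he

-- A constructible neighbourhood of `y` is cut out by open sets containing `y` and closed sets
-- containing `y`; the latter contain all of `s`.
theorem mem_closure_constructibleTopology_of_isGenericPoint {y : Y} {s : Set Y}
    (h : IsGenericPoint y (closure s)) : y ∈ closure[constructibleTopology Y] s := by
  have hne : (𝓝 y ⊓ 𝓟 s).NeBot := mem_closure_iff_clusterPt.1 h.mem
  have hle : 𝓝 y ⊓ 𝓟 s ≤ @nhds Y (constructibleTopology Y) y := by
    rw [nhds_generateFrom]
    refine le_iInf₂ fun u ⟨hyu, hu⟩ ↦ le_principal_iff.2 ?_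
    rcases hu with ⟨hopen, -⟩ | ⟨hclosed, -⟩
    · exact mem_inf_of_left (hopen.mem_nhds hyu)
    · exact mem_inf_of_right (subset_closure.trans ((h.mem_closed_set_iff hclosed).1 hyu))
  exact (@mem_closure_iff_clusterPt Y (constructibleTopology Y) y s).2
    (hne.mono (le_inf hle inf_le_right))

theorem quasiSober_of_isInducing [QuasiSober Y] (hf : IsInducing f)
    (hr : IsClosed[constructibleTopology Y] (range f)) : QuasiSober X where
  sober {Z} hZ hZc := by
    obtain ⟨y, hy⟩ : ∃ y, IsGenericPoint y (closure (f '' Z)) :=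
      QuasiSober.sober (hZ.image f hf.continuous.continuousOn).closure isClosed_closure
    have hsub : closure[constructibleTopology Y] (f '' Z) ⊆ range f :=
      @closure_minimal Y (constructibleTopology Y) _ _ (image_subset_range f Z) hr
    obtain ⟨x, rfl⟩ := hsub (mem_closure_constructibleTopology_of_isGenericPoint hy)
    refine ⟨x, ?_⟩
    rw [isGenericPoint_def, hf.closure_eq_preimage_closure_image, image_singleton, hy.def,
      ← hf.closure_eq_preimage_closure_image, hZc.closure_eq]

theorem isSpectralMap_of_isInducing [CompactSpace Y] [QuasiSober Y] [PrespectralSpace Y]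
    [QuasiSeparatedSpace Y] (hf : IsInducing f)
    (hr : IsClosed[constructibleTopology Y] (range f)) : IsSpectralMap f where
  toContinuous := hf.continuous
  isCompact_preimage_of_isOpen K ho hc := by
    rw [hf.isCompact_iff, image_preimage_eq_inter_range]
    exact isCompact_of_isClosed_constructibleTopology <|
      @IsClosed.inter _ _ _ (constructibleTopology Y)
        (isClopen_constructibleTopology_of_isCompact ho hc).1 hr

theorem quasiSeparatedSpace_of_isInducing [PrespectralSpace Y] [QuasiSeparatedSpace Y]
    (hf : IsInducing f) (hs : IsSpectralMap f) : QuasiSeparatedSpace X := by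
  refine .of_isTopologicalBasis (b := fun K : {K : Set Y // IsOpen K ∧ IsCompact K} ↦ f ⁻¹' K)
    ?_ fun ⟨K, hKo, hKc⟩ ⟨L, hLo, hLc⟩ ↦ ?_
  · rw [range_comp' (preimage f), Subtype.range_coe_subtype]
    exact PrespectralSpace.isTopologicalBasis.isInducing hf
  · exact hs.isCompact_preimage_of_isOpen (hKo.inter hLo) (hKc.inter_of_isOpen hLc hKo hLo)

theorem spectralSpace_of_isEmbedding [SpectralSpace Y] (hf : IsEmbedding f)
    (hr : IsClosed[constructibleTopology Y] (range f)) : SpectralSpace X :=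
  have hs : IsSpectralMap f := isSpectralMap_of_isInducing hf.isInducing hr
  { hf.t0Space, quasiSober_of_isInducing hf.isInducing hr,
    PrespectralSpace.of_isInducing f hf.isInducing hs,
    quasiSeparatedSpace_of_isInducing hf.isInducing hs with
    isCompact_univ := hs.isCompact_preimage_of_isOpen isOpen_univ isCompact_univ }

end ConstructibleTopology

section LowerTopology

variable {α : Type*} [CompleteLattice α] [TopologicalSpace α] [IsLower α]

theorem quasiSober_of_isLower : QuasiSober α where
  sober {Z} hZ hZc := by
    have hmem : sInf Z ∈ Z := by
      by_contra h
      obtain ⟨_, ⟨F, hF, rfl⟩, hzF, hFZ⟩ :=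
        IsLower.isTopologicalBasis.exists_subset_of_mem_open h hZc.isOpen_compl
      have hcover : Z ⊆ ⋃ a ∈ F, Ici a := coe_upperClosure F ▸ compl_subset_compl.1 hFZ
      obtain ⟨_, hI, hZI⟩ := isIrreducible_iff_sUnion_isClosed.1 hZ (hF.image Ici).toFinset
        (by simp [isClosed_Ici]) (by simpa using hcover)
      obtain ⟨a, haF, rfl⟩ := (hF.image Ici).mem_toFinset.1 hI
      exact hzF (mem_upperClosure.2 ⟨a, haF, le_sInf hZI⟩)
    refine ⟨sInf Z, ?_⟩
    rw [isGenericPoint_def, IsLower.closure_singleton]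
    exact ((IsLower.isUpperSet_of_isClosed hZc).Ici_subset hmem).antisymm fun z ↦ sInf_le

-- By Alexander's subbasis theorem only covers by sets `(Ici a)ᶜ`, `a ∈ A`, matter; such a family
-- covers iff some `k ∈ F` lies below `sSup A`.
theorem isCompact_compl_upperClosure {F : Set α} (hF : ∀ k ∈ F, IsCompactElement k) :
    IsCompact (upperClosure F : Set α)ᶜ := by
  refine isCompact_generateFrom (IsLower.topology_eq α) fun P hP hcover ↦ ?_
  let A : Set α := {a | (Ici a)ᶜ ∈ P}
  obtain ⟨k, hkF, hkA⟩ : sSup A ∈ upperClosure F := by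
    by_contra h
    obtain ⟨V, hV, hAV⟩ := hcover h
    obtain ⟨a, rfl⟩ := hP hV
    exact hAV (le_sSup (a := a) hV)
  obtain ⟨T, hTA, hkT⟩ :=
    (CompleteLattice.isCompactElement_iff_exists_le_sSup_of_le_sSup α k).1 (hF k hkF) A hkA
  refine ⟨(fun a ↦ (Ici a)ᶜ) '' T, image_subset_iff.2 hTA, T.finite_toSet.image _, fun x hx ↦ ?_⟩
  have hkx : ¬ k ≤ x := fun h ↦ hx (mem_upperClosure.2 ⟨k, hkF, h⟩)
  obtain ⟨a, haT, hax⟩ : ∃ a ∈ T, ¬ a ≤ x := by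
    by_contra! h
    exact hkx (hkT.trans (Finset.sup_le h))
  exact ⟨_, ⟨a, haT, rfl⟩, hax⟩

theorem isTopologicalBasis_compl_upperClosure [IsCompactlyGenerated α] :
    IsTopologicalBasis (range fun F : {F : Set α // F.Finite ∧ ∀ k ∈ F, IsCompactElement k} ↦
      (upperClosure F.1 : Set α)ᶜ) := by
  refine isTopologicalBasis_of_isOpen_of_nhds ?_ fun x U hx hU ↦ ?_
  · rintro _ ⟨F, rfl⟩
    exact (IsLower.isClosed_upperClosure F.2.1).isOpen_compl
  obtain ⟨_, ⟨F, hF, rfl⟩, hxF, hFU⟩ := IsLower.isTopologicalBasis.exists_subset_of_mem_open hx hU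
  have hk : ∀ a ∈ F, ∃ k, IsCompactElement k ∧ k ≤ a ∧ ¬ k ≤ x := fun a ha ↦ by
    by_contra! h
    exact hxF (mem_upperClosure.2 ⟨a, ha, le_iff_compact_le_imp.2 h⟩)
  choose! k hkc hka hkx using hk
  refine ⟨_, ⟨⟨k '' F, hF.image k, forall_mem_image.2 hkc⟩, rfl⟩, ?_, Subset.trans ?_ hFU⟩
  · simpa using hkx
  · refine compl_subset_compl.2 fun z hz ↦ ?_
    obtain ⟨a, ha, haz⟩ := mem_upperClosure.1 hz
    exact mem_upperClosure.2 ⟨k a, mem_image_of_mem k ha, (hka a ha).trans haz⟩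

theorem spectralSpace_of_isLower [IsCompactlyGenerated α] : SpectralSpace α :=
  { IsLower.t0Space (α := α), quasiSober_of_isLower (α := α),
    PrespectralSpace.of_isTopologicalBasis' isTopologicalBasis_compl_upperClosure
      fun F ↦ isCompact_compl_upperClosure F.2.2,
    QuasiSeparatedSpace.of_isTopologicalBasis (α := α) isTopologicalBasis_compl_upperClosure
      fun F G ↦ by
        rw [← compl_union, ← UpperSet.coe_inf, ← upperClosure_union]
        exact isCompact_compl_upperClosure fun k ↦ Or.rec (F.2.2 k) (G.2.2 k) with
    isCompact_univ := by
      simpa using isCompact_compl_upperClosure (α := α) (F := ∅) (by simp) }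

theorem isClopen_constructibleTopology_Ici {k : α} (hk : IsCompactElement k) :
    @IsClopen α (constructibleTopology α) (Ici k) := by
  have hc : IsCompact (Ici k)ᶜ := by
    simpa using isCompact_compl_upperClosure (F := {k}) (by simpa using hk)
  simpa only [compl_compl] using
    @IsClopen.compl α (constructibleTopology α) _
      (isClopen_constructibleTopology_of_isCompact isClosed_Ici.isOpen_compl hc)

end LowerTopology

section Powerset

variable {S : Type*}

theorem isCompactElement_singleton (a : S) : IsCompactElement ({a} : Set S) := by
  refine (CompleteLattice.isCompactElement_iff_le_of_directed_sSup_le _ _).2 fun s _ _ ha ↦ ?_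
  simpa using ha

theorem isCompactlyGenerated_set : IsCompactlyGenerated (Set S) where
  exists_sSup_eq A := ⟨singleton '' A, forall_mem_image.2 fun a _ ↦ isCompactElement_singleton a,
    by simp⟩

theorem powersetHullKernel_eq_lower : powersetHullKernel S = lower (Set S) := by
  refine le_antisymm (le_generateFrom ?_) (generateFrom_anti ?_)
  · rintro _ ⟨A, rfl⟩
    have h : (Ici A)ᶜ = ⋃ a ∈ A, {I : Set S | ¬ (({a} : Finset S) : Set S) ⊆ I} := by
      ext I
      simp [not_subset]
    rw [h]
    exact @isOpen_biUnion _ _ (powersetHullKernel S) _ _ fun a _ ↦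
      isOpen_generateFrom_of_mem ⟨{a}, rfl⟩
  · rintro _ ⟨A, rfl⟩
    exact ⟨A, rfl⟩

theorem spectralSpace_powersetHullKernel : @SpectralSpace (Set S) (powersetHullKernel S) :=
  let _ := powersetHullKernel S
  have : IsLower (Set S) := ⟨powersetHullKernel_eq_lower⟩
  have : IsCompactlyGenerated (Set S) := isCompactlyGenerated_set
  spectralSpace_of_isLower

theorem isClopen_powersetPatch_mem (a : S) : @IsClopen _ (powersetPatch S) {A | a ∈ A} := by
  let _ := powersetHullKernel S
  have : IsLower (Set S) := ⟨powersetHullKernel_eq_lower⟩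
  simpa [Ici] using isClopen_constructibleTopology_Ici (isCompactElement_singleton a)

end Powerset

section Ideals

variable {S : Type*} [CommSemiring S]

theorem isEmbedding_coe_hullKernel (X : Set (Ideal S)) :
    @IsEmbedding _ _ (hullKernel X) (powersetHullKernel S) fun I : X ↦ ((I : Ideal S) : Set S) := by
  let _ := powersetHullKernel S
  let _ := hullKernel X
  refine ⟨⟨?_⟩, SetLike.coe_injective.comp Subtype.val_injective⟩
  rw [induced_generateFrom_eq]
  refine congrArg generateFrom (Set.ext fun U ↦ ?_)
  exact ⟨fun ⟨A, h⟩ ↦ ⟨_, ⟨A, rfl⟩, h.symm⟩, fun ⟨_, ⟨A, rfl⟩, h⟩ ↦ ⟨A, h.symm⟩⟩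

theorem spectralSpace_hullKernel {X : Set (Ideal S)} (hX : IsPatchClosed X) :
    @SpectralSpace X (hullKernel X) := by
  let _ := powersetHullKernel S
  let _ := hullKernel X
  have := spectralSpace_powersetHullKernel (S := S)
  refine spectralSpace_of_isEmbedding (isEmbedding_coe_hullKernel X) ?_
  rwa [IsPatchClosed, image_eq_range] at hX

theorem range_coe_ideal : range ((↑) : Ideal S → Set S) =
    {A | 0 ∈ A ∧ (∀ a b, a ∈ A → b ∈ A → a + b ∈ A) ∧ ∀ c a, a ∈ A → c * a ∈ A} := by
  ext A
  constructor
  · rintro ⟨I, rfl⟩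
    exact ⟨I.zero_mem, fun _ _ ↦ I.add_mem, fun c _ ↦ I.mul_mem_left c⟩
  · rintro ⟨hzero, hadd, hmul⟩
    exact ⟨⟨⟨⟨A, hadd _ _⟩, hzero⟩, hmul⟩, rfl⟩

attribute [local instance] powersetPatch

theorem isClosed_range_coe_ideal : IsClosed (range ((↑) : Ideal S → Set S)) := by
  have h := isClopen_powersetPatch_mem (S := S)
  rw [range_coe_ideal]
  simp only [ofPred_and, ofPred_forall]
  refine (h 0).1.inter (.inter ?_ ?_)
  · exact isClosed_iInter fun a ↦ isClosed_iInter fun b ↦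
      isClosed_imp (h a).2 (isClosed_imp (h b).2 (h (a + b)).1)
  · exact isClosed_iInter fun c ↦ isClosed_iInter fun a ↦ isClosed_imp (h a).2 (h (c * a)).1

theorem isPatchClosed_preimage_coe {C : Set (Set S)} (hC : IsClosed C) :
    IsPatchClosed (((↑) : Ideal S → Set S) ⁻¹' C) := by
  rw [IsPatchClosed, image_preimage_eq_inter_range]
  exact hC.inter isClosed_range_coe_ideal

theorem isPatchClosed_inter {X Y : Set (Ideal S)} (hX : IsPatchClosed X) (hY : IsPatchClosed Y) :
    IsPatchClosed (X ∩ Y) := by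
  rw [IsPatchClosed, image_inter SetLike.coe_injective]
  exact IsClosed.inter hX hY

theorem isPatchClosed_strongIdeals : IsPatchClosed (strongIdeals S) := by
  have h := isClopen_powersetPatch_mem (S := S)
  have hstrong : IsClosed {A : Set S | ∀ a b, a + b ∈ A → a ∈ A ∧ b ∈ A} := by
    simp only [ofPred_forall]
    exact isClosed_iInter fun a ↦ isClosed_iInter fun b ↦
      isClosed_imp (h (a + b)).2 ((h a).1.inter (h b).1)
  exact isPatchClosed_preimage_coe hstrong

theorem isPatchClosed_setOf_ne_top : IsPatchClosed {I : Ideal S | I ≠ ⊤} := by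
  have hone : IsClosed {A : Set S | 1 ∉ A} := (isClopen_powersetPatch_mem 1).compl.1
  simp only [Ideal.ne_top_iff_one]
  exact isPatchClosed_preimage_coe hone

theorem isPatchClosed_setOf_isPrime : IsPatchClosed {I : Ideal S | I.IsPrime} := by
  have h := isClopen_powersetPatch_mem (S := S)
  have hprime : IsClosed {A : Set S | ∀ a b, a * b ∈ A → a ∈ A ∨ b ∈ A} := by
    simp only [ofPred_forall]
    exact isClosed_iInter fun a ↦ isClosed_iInter fun b ↦
      isClosed_imp (h (a * b)).2 ((h a).1.union (h b).1)
  simp only [Ideal.isPrime_iff]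
  exact isPatchClosed_inter isPatchClosed_setOf_ne_top (isPatchClosed_preimage_coe hprime)

end Ideals

theorem proposition4 (S : Type*) [CommSemiring S] :
    (@SpectralSpace (strongIdeals S) (hullKernel (strongIdeals S)) ∧
      IsPatchClosed (strongIdeals S)) ∧
    (@SpectralSpace (properStrongIdeals S) (hullKernel (properStrongIdeals S)) ∧
      IsPatchClosed (properStrongIdeals S)) ∧
    (@SpectralSpace (strongPrimeIdeals S) (hullKernel (strongPrimeIdeals S)) ∧
      IsPatchClosed (strongPrimeIdeals S)) := by
  have hstrong := isPatchClosed_strongIdeals (S := S)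
  have hproper := isPatchClosed_inter isPatchClosed_setOf_ne_top hstrong
  have hprime := isPatchClosed_inter isPatchClosed_setOf_isPrime hstrong
  exact ⟨⟨spectralSpace_hullKernel hstrong, hstrong⟩, ⟨spectralSpace_hullKernel hproper, hproper⟩,
    ⟨spectralSpace_hullKernel hprime, hprime⟩⟩
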